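/- Let $\mathbb{Z}[1/2]$ denote the dyadic rationals. Thompson's group $T$ is the group of homeomorphisms of the circle $\mathbb{R}/\mathbb{Z}$ that map $\mathbb{Z}[1/2]/\mathbb{Z}$ onto itself and are piecewise linear, with finitely many breakpoints, all in $\mathbb{Z}[1/2]/\mathbb{Z}$, and with slopes in $2^{\mathbb{Z}}=\{2^k:k\in\mathbb{Z}\}$. Thompson's group $F$ is the stabilizer of $0$ in $T$. Let $C^*_r(T)$ be the reduced C*-algebra of the discrete group $T$, that is, the C*-subalgebra of $B(\ell^2(T))$ generated by the image of the left regular representation of $T$. **Theorem.** If $F$ is amenable (that is, if there is a left-invariant mean on $\ell^\infty(F)$), then $C^*_r(T)$ has infinitely many closed two-sided ideals. -/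

import Mathlib

open scoped Topology ENNReal

noncomputable section

/-! ### Thompson's groups `T` and `F` -/

/-- The image of the dyadic rationals `ℤ[1/2]` in the circle `ℝ / ℤ`. -/
def dyadicPoints : Set UnitAddCircle :=
  {x | ∃ (a : ℤ) (n : ℕ), x = (((a : ℝ) / 2 ^ n : ℝ) : UnitAddCircle)}

/-- Near `x`, the homeomorphism `g` is affine and its slope is an integral power of `2`. -/
def IsAffineAt (g : UnitAddCircle ≃ₜ UnitAddCircle) (x : UnitAddCircle) : Prop :=
  ∃ k : ℤ, ∀ᶠ t : ℝ in 𝓝 0,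
    g (x + (t : UnitAddCircle)) = g x + (((2 : ℝ) ^ k * t : ℝ) : UnitAddCircle)

/-- The homeomorphism `g` of the circle maps the set of dyadic points onto itself, and it is
piecewise linear, with finitely many breakpoints, all of them dyadic, and with slopes in `2 ^ ℤ`
(on every arc of the complement of the finite set `B` the map is locally affine, so its slope is
constant there). -/
def IsThompson (g : UnitAddCircle ≃ₜ UnitAddCircle) : Prop :=
  (∀ x, g x ∈ dyadicPoints ↔ x ∈ dyadicPoints) ∧
    ∃ B : Set UnitAddCircle, B.Finite ∧ B ⊆ dyadicPoints ∧ ∀ x, x ∉ B → IsAffineAt g x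

theorem IsAffineAt.comp {g h : UnitAddCircle ≃ₜ UnitAddCircle} {x : UnitAddCircle}
    (hg : IsAffineAt g (h x)) (hh : IsAffineAt h x) : IsAffineAt (g * h) x := by
  obtain ⟨k, hk⟩ := hg
  obtain ⟨l, hl⟩ := hh
  refine ⟨k + l, ?_⟩
  have hc : Filter.Tendsto (fun t : ℝ => (2 : ℝ) ^ l * t) (𝓝 0) (𝓝 0) := by
    have : Continuous (fun t : ℝ => (2 : ℝ) ^ l * t) := by fun_prop
    simpa using this.tendsto 0
  filter_upwards [hl, hc.eventually hk] with t h1 h2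
  rw [zpow_add₀ (two_ne_zero), mul_assoc]
  show g (h _) = g (h _) + _
  rw [h1, h2]

theorem IsAffineAt.inv {g : UnitAddCircle ≃ₜ UnitAddCircle} {x : UnitAddCircle}
    (hg : IsAffineAt g x) : IsAffineAt g⁻¹ (g x) := by
  obtain ⟨k, hk⟩ := hg
  refine ⟨-k, ?_⟩
  have hc : Filter.Tendsto (fun t : ℝ => (2 : ℝ) ^ (-k) * t) (𝓝 0) (𝓝 0) := by
    have : Continuous (fun t : ℝ => (2 : ℝ) ^ (-k) * t) := by fun_prop
    simpa using this.tendsto 0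
  filter_upwards [hc.eventually hk] with t h2
  rw [← mul_assoc, ← zpow_add₀ (two_ne_zero), add_neg_cancel, zpow_zero, one_mul] at h2
  rw [← h2]
  show g.symm (g _) = g.symm (g _) + _
  rw [g.symm_apply_apply, g.symm_apply_apply]

/-- Thompson's group `T`. -/
def thompsonT : Subgroup (UnitAddCircle ≃ₜ UnitAddCircle) where
  carrier := {g | IsThompson g}
  one_mem' := by
    refine ⟨fun x => Iff.rfl, ∅, Set.finite_empty, Set.empty_subset _, fun x _ => ⟨0, ?_⟩⟩
    filter_upwards with t
    simp
  mul_mem' := by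
    rintro g h ⟨hg, B, hB, hBd, hBa⟩ ⟨hh, C, hC, hCd, hCa⟩
    refine ⟨fun x => (hg (h x)).trans (hh x), C ∪ h ⁻¹' B,
      hC.union (hB.preimage h.injective.injOn), ?_, ?_⟩
    · rintro x (hx | hx)
      · exact hCd hx
      · exact (hh x).1 (hBd hx)
    · intro x hx
      simp only [Set.mem_union, not_or] at hx
      exact (hBa _ hx.2).comp (hCa _ hx.1)
  inv_mem' := by
    rintro g ⟨hg, B, hB, hBd, hBa⟩
    have hr : ∀ x, g (g⁻¹ x) = x := fun x => g.apply_symm_apply x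
    refine ⟨fun x => ?_, g '' B, hB.image _, ?_, ?_⟩
    · rw [← hg, hr]
    · rintro _ ⟨x, hx, rfl⟩
      exact (hg x).2 (hBd hx)
    · intro x hx
      rw [← hr x]
      exact (hBa _ fun h => hx ⟨_, h, hr x⟩).inv

/-- Thompson's group `F`: the stabilizer of `0` in `T`. -/
def thompsonF : Subgroup thompsonT where
  carrier := {g | (g : UnitAddCircle ≃ₜ UnitAddCircle) 0 = 0}
  one_mem' := rfl
  mul_mem' := by
    intro g h (hg : g.1 0 = 0) (hh : h.1 0 = 0)
    show g.1 (h.1 0) = 0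
    rw [hh, hg]
  inv_mem' := by
    intro g (hg : g.1 0 = 0)
    show g.1.symm 0 = 0
    rw [← hg, g.1.symm_apply_apply, hg]

/-! ### Amenability of discrete groups -/

/-- The left translate `x ↦ f (g⁻¹ x)` of a bounded function `f` on a group. -/
def translateBounded {G : Type*} [Group G] (g : G) (f : lp (fun _ : G => ℝ) ∞) :
    lp (fun _ : G => ℝ) ∞ :=
  ⟨fun x => f (g⁻¹ * x), memℓp_infty <| by
    obtain ⟨C, hC⟩ := memℓp_infty_iff.1 (lp.memℓp f)
    refine ⟨C, ?_⟩
    rintro _ ⟨x, rfl⟩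
    exact hC ⟨g⁻¹ * x, rfl⟩⟩

/-- A discrete group `G` is amenable if there is a left-invariant mean on `ℓ^∞(G)`, that is, a
positive unital linear functional that is invariant under left translations. -/
def IsAmenableGroup (G : Type*) [Group G] : Prop :=
  ∃ m : lp (fun _ : G => ℝ) ∞ →ₗ[ℝ] ℝ,
    (∀ f : lp (fun _ : G => ℝ) ∞, (∀ x, 0 ≤ f x) → 0 ≤ m f) ∧
    m 1 = 1 ∧
    ∀ (g : G) (f : lp (fun _ : G => ℝ) ∞), m (translateBounded g f) = m f

/-! ### The reduced group C*-algebra -/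

/-- The Hilbert space `ℓ²(G)`. -/
abbrev EllTwo (G : Type*) : Type _ := lp (fun _ : G => ℂ) 2

/-- The left translate `x ↦ f (g⁻¹ x)` of a square-summable function `f` on a group. -/
def translateEllTwo {G : Type*} [Group G] (g : G) (f : EllTwo G) : EllTwo G :=
  ⟨fun x => f (g⁻¹ * x), by
    have h := (memℓp_gen_iff (by norm_num : (0 : ℝ) < (2 : ℝ≥0∞).toReal)).1 (lp.memℓp f)
    exact memℓp_gen ((Equiv.mulLeft g⁻¹).summable_iff.2 h)⟩

theorem norm_translateEllTwo {G : Type*} [Group G] (g : G) (f : EllTwo G) :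
    ‖translateEllTwo g f‖ = ‖f‖ := by
  have h2 : (0 : ℝ) < (2 : ℝ≥0∞).toReal := by norm_num
  rw [lp.norm_eq_tsum_rpow h2, lp.norm_eq_tsum_rpow h2]
  congr 1
  exact (Equiv.mulLeft g⁻¹).tsum_eq fun x => ‖f x‖ ^ (2 : ℝ≥0∞).toReal

/-- The left regular representation `λ` of `G` on `ℓ²(G)`: `(λ_g f)(x) = f (g⁻¹ x)`, so that
`λ_g δ_h = δ_{gh}`. -/
def leftRegular (G : Type*) [Group G] : G →* (EllTwo G →L[ℂ] EllTwo G) where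
  toFun g :=
    LinearIsometry.toContinuousLinearMap
      { toFun := translateEllTwo g
        map_add' := fun _ _ => rfl
        map_smul' := fun _ _ => rfl
        norm_map' := norm_translateEllTwo g }
  map_one' := by
    ext f x
    show f ((1 : G)⁻¹ * x) = f x
    simp
  map_mul' g h := by
    ext f x
    show f ((g * h)⁻¹ * x) = f (h⁻¹ * (g⁻¹ * x))
    rw [mul_inv_rev, mul_assoc]

/-- The reduced C*-algebra `C*_r(G)`: the C*-subalgebra of `B(ℓ²(G))` generated by the image of the
left regular representation. -/
def reducedGroupCStar (G : Type*) [Group G] : StarSubalgebra ℂ (EllTwo G →L[ℂ] EllTwo G) :=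
  (StarAlgebra.adjoin ℂ (Set.range (leftRegular G))).topologicalClosure

end

/-! `T` acts on tuples of points of the circle. If a tuple has `0` among its entries, its stabilizer
lies in `F` and is therefore amenable. Almost invariant vectors of the stabilizer then show that the
matrix coefficients of the permutation representation on the orbit are bounded by the reduced norm
(`norm_coeff_permAlgebraHom_le`). So closing the annihilator of the orbit in `C*_r(T)` adds no new
element of the group algebra (`mem_orbitAnnihilator_of_mem_annihilatorIdeal`), and different
annihilators give different closed ideals.

Annihilators for different tuple lengths are separated by products of `n` factors `1 - g i`, where
the `g i` have disjoint supports. Such a product kills every tuple of fewer than `n` points, since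
by pigeonhole some `g i` fixes it. It does not kill an `n`-tuple whose `i`-th entry is moved by `g
i`. -/

/-! ### Amenability of subgroups -/

/-- Precomposition of a bounded function with an arbitrary map. -/
def lpInftyComp {A K : Type*} (κ : A → K) :
    lp (fun _ : K => ℝ) ∞ →ₗ[ℝ] lp (fun _ : A => ℝ) ∞ where
  toFun f := ⟨fun a => f (κ a), memℓp_infty <| by
    obtain ⟨C, hC⟩ := memℓp_infty_iff.1 (lp.memℓp f)
    refine ⟨C, ?_⟩
    rintro _ ⟨x, rfl⟩
    exact hC ⟨κ x, rfl⟩⟩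
  map_add' _ _ := rfl
  map_smul' _ _ := rfl

/-- With a transversal of the right cosets of the image of `j`, every element is uniquely `j k * t`;
`κ` returns `k`. -/
theorem Subgroup.exists_equivariant_retraction {A K : Type*} [Group A] [Group K] (j : K →* A)
    (hj : Function.Injective j) : ∃ κ : A → K, ∀ k a, κ (j k * a) = k * κ a := by
  obtain ⟨T, hT, -⟩ := j.range.exists_isComplement_right 1
  let e := MonoidHom.ofInjective hj
  refine ⟨fun a => e.symm (hT.equiv a).1, fun k a => ?_⟩
  have h : (hT.equiv (j k * a)).1 = e k * (hT.equiv a).1 :=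
    congrArg Prod.fst (hT.equiv_mul_left (e k) a)
  simp only [h, map_mul, MulEquiv.symm_apply_apply]

theorem IsAmenableGroup.of_injective {A K : Type*} [Group A] [Group K] (h : IsAmenableGroup A)
    (j : K →* A) (hj : Function.Injective j) : IsAmenableGroup K := by
  obtain ⟨m, hpos, hone, hinv⟩ := h
  obtain ⟨κ, hκ⟩ := Subgroup.exists_equivariant_retraction j hj
  refine ⟨m ∘ₗ lpInftyComp κ, fun f hf => hpos _ fun x => hf _, ?_, fun g f => ?_⟩
  · exact hone
  · have : lpInftyComp κ (translateBounded g f) = translateBounded (j g) (lpInftyComp κ f) := by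
      ext a
      change f (g⁻¹ * κ a) = f (κ ((j g)⁻¹ * a))
      rw [← map_inv, hκ]
    rw [LinearMap.comp_apply, this, hinv, LinearMap.comp_apply]

/-! ### From invariant means to almost invariant vectors -/

section

open scoped Classical in
/-- Day's convexity argument. -/
theorem IsAmenableGroup.zero_mem_closure_convexHull {G : Type*} [Group G] {K : Subgroup G}
    (hK : IsAmenableGroup K) (S : Finset K) :
    (0 : S → lp (fun _ : G => ℝ) 1) ∈ closure (convexHull ℝ (Set.range fun (x : K) (k : S) =>
      lp.single 1 ((k : K) * x : G) (1 : ℝ) - lp.single 1 (x : G) (1 : ℝ))) := by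
  by_contra h
  obtain ⟨φ, u, h1, h2⟩ := geometric_hahn_banach_closed_point
    (convex_convexHull ℝ _).closure isClosed_closure h
  rw [map_zero] at h2
  obtain ⟨m, hpos, hone, hinv⟩ := hK
  -- The `k`-th component of the separating functional `φ`, evaluated at point masses, is a bounded
  -- function on `K`. The combination `D` of translation differences has mean zero, yet its values
  -- are those of `φ` on the generators of the convex set, hence below `u < 0`.
  let B : S → lp (fun _ : K => ℝ) ∞ := fun k =>
    ⟨fun x => φ (Pi.single k (lp.single 1 (x : G) (1 : ℝ))), memℓp_infty <| by
      refine ⟨‖φ‖, ?_⟩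
      rintro _ ⟨x, rfl⟩
      refine (φ.le_opNorm _).trans ?_
      rw [Pi.norm_single, lp.norm_single one_pos]
      simp⟩
  let D : lp (fun _ : K => ℝ) ∞ := ∑ k : S, (translateBounded (k : K)⁻¹ (B k) - B k)
  have hD0 : m D = 0 := by
    simp only [D, map_sum, map_sub, hinv, sub_self, Finset.sum_const_zero]
  have hDx : ∀ x, D x < u := by
    intro x
    have h3 := h1 _ (subset_closure (subset_convexHull ℝ _ ⟨x, rfl⟩))
    refine lt_of_eq_of_lt ?_ h3
    beta_reduce
    rw [← Finset.univ_sum_single (fun k : S =>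
      lp.single (E := fun _ : G => ℝ) 1 ((k : K) * x : G) (1 : ℝ) -
        lp.single (E := fun _ : G => ℝ) 1 (x : G) (1 : ℝ)), map_sum]
    simp only [D, lp.coeFn_sum, Finset.sum_apply, lp.coeFn_sub, Pi.sub_apply]
    refine Finset.sum_congr rfl fun k _ => ?_
    rw [Pi.single_sub, map_sub]
    change φ (Pi.single k (lp.single 1 ((((k : K)⁻¹)⁻¹ * x : K) : G) (1 : ℝ))) - _ = _
    rw [inv_inv]
    rfl
  have h4 := hpos (u • 1 - D) fun x => by
    change 0 ≤ u * 1 - D x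
    linarith [hDx x]
  rw [map_sub, map_smul, hone, hD0, smul_eq_mul] at h4
  linarith

end

/-- Reiter's condition. -/
theorem IsAmenableGroup.exists_reiter {G : Type*} [Group G] {K : Subgroup G}
    (hK : IsAmenableGroup K) (S : Finset K) {ε : ℝ} (hε : 0 < ε) :
    ∃ f : G → ℝ, (∀ h, 0 ≤ f h) ∧ (∀ h ∉ K, f h = 0) ∧ HasSum f 1 ∧
      ∀ k ∈ S, ∃ c ≤ ε, HasSum (fun h => |f ((k : G)⁻¹ * h) - f h|) c := by
  classical
  obtain ⟨y, hy, hyε⟩ := Metric.mem_closure_iff.1 (hK.zero_mem_closure_convexHull S) ε hε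
  obtain ⟨ι, _, w, z, hw0, hw1, hz, rfl⟩ := mem_convexHull_iff_exists_fintype.1 hy
  choose x hx using hz
  refine ⟨fun h => ∑ i, w i * (Pi.single (x i : G) 1 : G → ℝ) h, fun h => ?_, fun h hh => ?_, ?_,
    fun k hk => ?_⟩
  · refine Finset.sum_nonneg fun i _ => mul_nonneg (hw0 i) ?_
    rw [Pi.single_apply]
    split_ifs <;> norm_num
  · refine Finset.sum_eq_zero fun i _ => ?_
    rw [Pi.single_eq_of_ne, mul_zero]
    rintro rfl
    exact hh (x i).2
  · have h := hasSum_sum (s := Finset.univ) fun i _ =>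
      (hasSum_pi_single (x i : G) (1 : ℝ)).mul_left (w i)
    simpa only [mul_one, hw1] using h
  · set v := (∑ i, w i • z i) ⟨k, hk⟩ with hv
    have hvn : ‖v‖ ≤ ε := by
      refine (norm_le_pi_norm (∑ i, w i • z i) ⟨k, hk⟩).trans ?_
      rw [dist_zero_left] at hyε
      exact hyε.le
    refine ⟨‖v‖, hvn, ?_⟩
    have := lp.hasSum_norm (p := 1) (by simp) v
    simp only [ENNReal.toReal_one, Real.rpow_one] at this
    convert this using 2 with h
    rw [Real.norm_eq_abs, hv]
    congr 1
    simp only [← hx, Finset.sum_apply, Pi.smul_apply, lp.coeFn_sum, lp.coeFn_smul, lp.coeFn_sub,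
      Pi.sub_apply, lp.coeFn_single, smul_eq_mul, mul_sub, Finset.sum_sub_distrib]
    congr 1
    refine Finset.sum_congr rfl fun i _ => ?_
    simp only [Pi.single_apply, inv_mul_eq_iff_eq_mul]

theorem Real.sqrt_sub_sqrt_sq_le {a b : ℝ} (ha : 0 ≤ a) (hb : 0 ≤ b) :
    (√a - √b) ^ 2 ≤ |a - b| := by
  have h1 := Real.sq_sqrt ha
  have h2 := Real.sq_sqrt hb
  have h3 := Real.sqrt_nonneg a
  have h4 := Real.sqrt_nonneg b
  rcases le_total (√a) (√b) with h | h
  · refine le_trans ?_ (neg_le_abs _)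
    nlinarith
  · refine le_trans ?_ (le_abs_self _)
    nlinarith

/-- Almost invariant unit vectors supported on an amenable subgroup. -/
theorem IsAmenableGroup.exists_almost_invariant {G : Type*} [Group G] {K : Subgroup G}
    (hK : IsAmenableGroup K) (S : Finset K) {ε : ℝ} (hε : 0 < ε) :
    ∃ ξ : EllTwo G, ‖ξ‖ = 1 ∧ (∀ h ∉ K, ξ h = 0) ∧
      ∀ k ∈ S, ‖leftRegular G k ξ - ξ‖ ≤ ε := by
  -- Square roots turn an `ℓ¹` estimate by `ε ^ 2` into an `ℓ²` estimate by `ε`.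
  obtain ⟨f, hf0, hfK, hf1, hfS⟩ := hK.exists_reiter S (pow_pos hε 2)
  have h2 : (0 : ℝ) < (2 : ℝ≥0∞).toReal := by norm_num
  have hn : ∀ h, ‖((√(f h) : ℝ) : ℂ)‖ ^ (2 : ℝ≥0∞).toReal = f h := by
    intro h
    rw [Complex.norm_real, Real.norm_of_nonneg (Real.sqrt_nonneg _), ENNReal.toReal_ofNat,
      Real.rpow_two, Real.sq_sqrt (hf0 h)]
  let ξ : EllTwo G := ⟨fun h => ((√(f h) : ℝ) : ℂ), memℓp_gen <| by
    simpa only [hn] using hf1.summable⟩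
  refine ⟨ξ, ?_, fun h hh => ?_, fun k hk => ?_⟩
  · rw [lp.norm_eq_tsum_rpow h2]
    change (∑' h, ‖((√(f h) : ℝ) : ℂ)‖ ^ (2 : ℝ≥0∞).toReal) ^ _ = _
    simp only [hn, hf1.tsum_eq, Real.one_rpow]
  · change ((√(f h) : ℝ) : ℂ) = 0
    simp [hfK h hh]
  · obtain ⟨c, hc, hsum⟩ := hfS k hk
    have h3 := lp.hasSum_norm h2 (leftRegular G k ξ - ξ)
    rw [ENNReal.toReal_ofNat, Real.rpow_two] at h3
    refine abs_le_of_sq_le_sq' ?_ hε.le |>.2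
    refine le_trans (hasSum_le (fun h => ?_) h3 hsum) hc
    change ‖((√(f ((k : G)⁻¹ * h)) : ℝ) : ℂ) - ((√(f h) : ℝ) : ℂ)‖ ^ (2 : ℝ) ≤ _
    rw [← Complex.ofReal_sub, Complex.norm_real, Real.rpow_two, Real.norm_eq_abs, sq_abs]
    exact Real.sqrt_sub_sqrt_sq_le (hf0 _) (hf0 _)

/-! ### The group algebra inside the reduced C*-algebra -/

/-- The regular representation as a homomorphism from the group algebra to `C*_r(G)`. -/
noncomputable def groupAlgebraToReduced (G : Type*) [Group G] :
    MonoidAlgebra ℂ G →ₐ[ℂ] reducedGroupCStar G :=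
  MonoidAlgebra.lift ℂ _ G
    ((leftRegular G).codRestrict (reducedGroupCStar G) fun g =>
      StarSubalgebra.le_topologicalClosure _ (StarAlgebra.subset_adjoin ℂ _ ⟨g, rfl⟩))

theorem coe_groupAlgebraToReduced {G : Type*} [Group G] (x : MonoidAlgebra ℂ G) :
    (groupAlgebraToReduced G x : EllTwo G →L[ℂ] EllTwo G) =
      MonoidAlgebra.lift ℂ _ G (leftRegular G) x := by
  induction x using MonoidAlgebra.induction_linear with
  | zero => simp
  | add x y hx hy => simp [hx, hy]
  | single g c =>
    simp only [groupAlgebraToReduced, MonoidAlgebra.lift_single]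
    rfl

theorem coe_groupAlgebraToReduced_of {G : Type*} [Group G] (g : G) :
    (groupAlgebraToReduced G (MonoidAlgebra.of ℂ G g) : EllTwo G →L[ℂ] EllTwo G) =
      leftRegular G g := by
  rw [coe_groupAlgebraToReduced, MonoidAlgebra.lift_of]

theorem inner_leftRegular {G : Type*} [Group G] (g : G) (ξ η : EllTwo G) :
    inner ℂ (leftRegular G g ξ) (leftRegular G g η) = inner ℂ ξ η := by
  rw [lp.inner_eq_tsum, lp.inner_eq_tsum]
  exact (Equiv.mulLeft g⁻¹).tsum_eq fun x => inner ℂ (ξ x) (η x)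

theorem norm_leftRegular_apply {G : Type*} [Group G] (g : G) (ξ : EllTwo G) :
    ‖leftRegular G g ξ‖ = ‖ξ‖ :=
  norm_translateEllTwo g ξ

theorem star_leftRegular {G : Type*} [Group G] (g : G) :
    star (leftRegular G g) = leftRegular G g⁻¹ := by
  rw [ContinuousLinearMap.star_eq_adjoint, eq_comm, ContinuousLinearMap.eq_adjoint_iff]
  intro ξ η
  rw [← inner_leftRegular g, ← mul_apply_eq_comp, ← map_mul]
  simp

/-- The generating set is closed under `star`, so the star algebra it generates is just the image of
the group algebra. Density lets closures of ideals of the group algebra be ideals of `C*_r(G)`. -/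
theorem denseRange_groupAlgebraToReduced (G : Type*) [Group G] :
    DenseRange (groupAlgebraToReduced G) := by
  intro a
  have hstar : star (Set.range (leftRegular G)) = Set.range (leftRegular G) := by
    ext T
    constructor
    · rintro ⟨g, hg⟩
      exact ⟨g⁻¹, by rw [← star_leftRegular, hg, star_star]⟩
    · rintro ⟨g, rfl⟩
      exact ⟨g⁻¹, (star_leftRegular g).symm⟩
  have hrange : ∀ T ∈ StarAlgebra.adjoin ℂ (Set.range (leftRegular G)),
      T ∈ Set.range (fun x => (groupAlgebraToReduced G x : EllTwo G →L[ℂ] EllTwo G)) := by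
    intro T hT
    rw [← StarSubalgebra.mem_toSubalgebra, StarAlgebra.adjoin_toSubalgebra, hstar,
      Set.union_self] at hT
    have h : Algebra.adjoin ℂ (Set.range (leftRegular G)) ≤
        (MonoidAlgebra.lift ℂ _ G (leftRegular G)).range := by
      rw [Algebra.adjoin_le_iff]
      rintro _ ⟨g, rfl⟩
      exact ⟨MonoidAlgebra.of ℂ G g, MonoidAlgebra.lift_of _ g⟩
    obtain ⟨x, hx⟩ := h hT
    exact ⟨x, (coe_groupAlgebraToReduced x).trans hx⟩
  have ha : (a : EllTwo G →L[ℂ] EllTwo G) ∈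
      closure (StarAlgebra.adjoin ℂ (Set.range (leftRegular G)) : Set _) := a.2
  rw [closure_subtype]
  refine closure_mono ?_ ha
  intro T hT
  obtain ⟨x, rfl⟩ := hrange T hT
  exact ⟨_, ⟨x, rfl⟩, rfl⟩

open scoped Classical in
/-- Summation over a left coset of an amenable subgroup is bounded for the reduced norm. -/
theorem IsAmenableGroup.norm_sum_coset_le {G : Type*} [Group G] {K : Subgroup G}
    (hK : IsAmenableGroup K) (s : G) (x : MonoidAlgebra ℂ G) :
    ‖x.coeff.sum fun g c => if s⁻¹ * g ∈ K then c else 0‖ ≤ ‖groupAlgebraToReduced G x‖ := by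
  set C := ∑ g ∈ x.coeff.support, ‖x.coeff g‖ with hC
  have hC0 : 0 ≤ C := Finset.sum_nonneg fun _ _ => norm_nonneg _
  refine le_of_forall_pos_le_add fun ε hε => ?_
  -- Only the finitely many `k` with `s * k` in the support of `x` matter. The coefficient of `x ξ`
  -- along the translate of `ξ` by `s` is then nearly the coset sum; `C + 1` avoids division by
  -- zero.
  obtain ⟨ξ, hξ1, hξK, hξS⟩ := hK.exists_almost_invariant
    (x.coeff.support.preimage (fun k : K => s * k)
      (fun a _ b _ h => Subtype.ext (mul_left_cancel h))) (show 0 < ε / (C + 1) by positivity)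
  have hinner : ‖inner ℂ (leftRegular G s ξ) ((groupAlgebraToReduced G x).1 ξ)‖ ≤
      ‖groupAlgebraToReduced G x‖ := by
    refine (norm_inner_le_norm _ _).trans ?_
    rw [norm_leftRegular_apply, hξ1, one_mul]
    refine ((groupAlgebraToReduced G x).1.le_opNorm ξ).trans ?_
    rw [hξ1, mul_one]
    rfl
  have hexp : inner ℂ (leftRegular G s ξ) ((groupAlgebraToReduced G x).1 ξ) =
      ∑ g ∈ x.coeff.support, x.coeff g * inner ℂ ξ (leftRegular G (s⁻¹ * g) ξ) := by
    rw [coe_groupAlgebraToReduced, MonoidAlgebra.lift_apply, Finsupp.sum,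
      _root_.sum_apply, inner_sum]
    refine Finset.sum_congr rfl fun g _ => ?_
    rw [_root_.smul_apply, inner_smul_right, ← inner_leftRegular s⁻¹,
      ← mul_apply_eq_comp, ← mul_apply_eq_comp, ← map_mul, ← map_mul,
      inv_mul_cancel, map_one, one_apply_eq_self]
  have hterm : ∀ g ∈ x.coeff.support, ‖(if s⁻¹ * g ∈ K then x.coeff g else 0) -
      x.coeff g * inner ℂ ξ (leftRegular G (s⁻¹ * g) ξ)‖ ≤ ‖x.coeff g‖ * (ε / (C + 1)) := by
    intro g hg
    split_ifs with h
    · have h1 := hξS ⟨s⁻¹ * g, h⟩ (Finset.mem_preimage.2 (by simpa using hg))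
      have h2 : x.coeff g - x.coeff g * inner ℂ ξ (leftRegular G (s⁻¹ * g) ξ) =
          - (x.coeff g * inner ℂ ξ (leftRegular G (s⁻¹ * g) ξ - ξ)) := by
        rw [inner_sub_right, inner_self_eq_norm_sq_to_K, hξ1]
        push_cast
        ring
      rw [h2, norm_neg, norm_mul]
      gcongr
      refine (norm_inner_le_norm _ _).trans ?_
      rwa [hξ1, one_mul]
    -- The translate of `ξ` lives on a left coset of `K` other than `K` itself, so the supports are
    -- disjoint.
    · have h0 : inner ℂ ξ (leftRegular G (s⁻¹ * g) ξ) = 0 := by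
        rw [lp.inner_eq_tsum]
        convert tsum_zero with k
        by_cases hk : k ∈ K
        · have : (leftRegular G (s⁻¹ * g) ξ) k = 0 := by
            refine hξK _ fun h' => h ?_
            have := K.mul_mem hk (K.inv_mem h')
            simpa using this
          rw [this, inner_zero_right]
        · rw [hξK k hk, inner_zero_left]
      rw [h0, mul_zero, sub_zero, norm_zero]
      positivity
  rw [hexp] at hinner
  have hdiff : ‖(x.coeff.sum fun g c => if s⁻¹ * g ∈ K then c else 0) -
      ∑ g ∈ x.coeff.support, x.coeff g * inner ℂ ξ (leftRegular G (s⁻¹ * g) ξ)‖ ≤ ε := by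
    rw [Finsupp.sum, ← Finset.sum_sub_distrib]
    refine (norm_sum_le_of_le _ hterm).trans ?_
    rw [← Finset.sum_mul, ← hC, mul_div_assoc', div_le_iff₀ (by positivity)]
    nlinarith
  calc _ ≤ _ := norm_le_norm_add_norm_sub' _ _
    _ ≤ _ := add_le_add hinner hdiff

/-! ### Orbit annihilators and their closures -/

section

variable {G Y : Type*} [Group G] [MulAction G Y]

/-- The permutation representation of the group algebra of `G` on the free module on `Y`. -/
noncomputable def permAlgebraHom (G Y : Type*) [Group G] [MulAction G Y] :
    MonoidAlgebra ℂ G →ₐ[ℂ] Module.End ℂ (MonoidAlgebra ℂ Y) :=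
  (Representation.ofMulAction ℂ G Y).asAlgebraHom

theorem permAlgebraHom_of_single (g : G) (y : Y) (c : ℂ) :
    permAlgebraHom G Y (MonoidAlgebra.of ℂ G g) (MonoidAlgebra.single y c) =
      MonoidAlgebra.single (g • y) c := by
  rw [permAlgebraHom, Representation.asAlgebraHom_of, Representation.ofMulAction_single]

/-- The elements of the group algebra that annihilate the orbit of `y`. -/
def orbitAnnihilator (G : Type*) {Y : Type*} [Group G] [MulAction G Y] (y : Y) :
    Submodule ℂ (MonoidAlgebra ℂ G) where
  carrier := {x | ∀ b : G, permAlgebraHom G Y x (MonoidAlgebra.single (b • y) 1) = 0}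
  zero_mem' b := by rw [map_zero, LinearMap.zero_apply]
  add_mem' hx hx' b := by rw [map_add, LinearMap.add_apply, hx b, hx' b, add_zero]
  smul_mem' c x hx b := by rw [map_smul, LinearMap.smul_apply, hx b, smul_zero]

theorem mul_mem_orbitAnnihilator_left {y : Y} (a : MonoidAlgebra ℂ G) {x : MonoidAlgebra ℂ G}
    (hx : x ∈ orbitAnnihilator G y) : a * x ∈ orbitAnnihilator G y := fun b => by
  rw [map_mul, Module.End.mul_apply, hx b, map_zero]

/-- Right multiplication by `g` moves the base point `b • y` to `(g * b) • y`; this is why the whole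
orbit has to be annihilated. -/
theorem mul_mem_orbitAnnihilator_right {y : Y} (a : MonoidAlgebra ℂ G) {x : MonoidAlgebra ℂ G}
    (hx : x ∈ orbitAnnihilator G y) : x * a ∈ orbitAnnihilator G y := fun b => by
  induction a using MonoidAlgebra.induction_linear with
  | zero => rw [mul_zero, map_zero, LinearMap.zero_apply]
  | add a a' ha ha' => rw [mul_add, map_add, LinearMap.add_apply, ha, ha', add_zero]
  | single g c =>
    rw [← mul_one c, ← MonoidAlgebra.smul_single', ← MonoidAlgebra.of_apply, mul_smul_comm,
      map_smul, LinearMap.smul_apply, map_mul, Module.End.mul_apply, permAlgebraHom_of_single,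
      ← mul_smul, hx, smul_zero]

theorem permAlgebraHom_apply (x : MonoidAlgebra ℂ G) (v : MonoidAlgebra ℂ Y) :
    permAlgebraHom G Y x v =
      ∑ g ∈ x.coeff.support, x.coeff g • permAlgebraHom G Y (MonoidAlgebra.of ℂ G g) v := by
  simp only [permAlgebraHom, Representation.asAlgebraHom_of]
  rw [Representation.asAlgebraHom_def, MonoidAlgebra.lift_apply, Finsupp.sum, LinearMap.sum_apply]
  rfl

theorem norm_groupAlgebraToReduced_of_le (g : G) :
    ‖groupAlgebraToReduced G (MonoidAlgebra.of ℂ G g)‖ ≤ 1 := by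
  change ‖(groupAlgebraToReduced G (MonoidAlgebra.of ℂ G g)).1‖ ≤ 1
  rw [coe_groupAlgebraToReduced_of]
  exact ContinuousLinearMap.opNorm_le_bound _ zero_le_one fun ξ => by
    rw [norm_leftRegular_apply, one_mul]

/-- Matrix coefficients of a transitive permutation representation with amenable stabilizers are
bounded for the reduced norm. -/
theorem norm_coeff_permAlgebraHom_le {y : Y} (hy : IsAmenableGroup (MulAction.stabilizer G y))
    (x : MonoidAlgebra ℂ G) (b : G) (z : Y) :
    ‖(permAlgebraHom G Y x (MonoidAlgebra.single (b • y) 1)).coeff z‖ ≤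
      ‖groupAlgebraToReduced G x‖ := by
  classical
  have h1 : permAlgebraHom G Y x (MonoidAlgebra.single (b • y) 1) =
      permAlgebraHom G Y (x * MonoidAlgebra.of ℂ G b) (MonoidAlgebra.single y 1) := by
    rw [map_mul, Module.End.mul_apply, permAlgebraHom_of_single]
  have h2 : ‖groupAlgebraToReduced G (x * MonoidAlgebra.of ℂ G b)‖ ≤
      ‖groupAlgebraToReduced G x‖ := by
    rw [map_mul]
    refine (norm_mul_le _ _).trans ?_
    exact mul_le_of_le_one_right (norm_nonneg _) (norm_groupAlgebraToReduced_of_le b)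
  rw [h1]
  refine le_trans ?_ h2
  generalize x * MonoidAlgebra.of ℂ G b = x
  rw [permAlgebraHom_apply]
  simp only [permAlgebraHom_of_single, MonoidAlgebra.coeff_sum, MonoidAlgebra.coeff_smul,
    Finsupp.finsetSum_apply, Finsupp.smul_apply, MonoidAlgebra.coeff_single,
    Finsupp.single_apply, smul_eq_mul, mul_ite, mul_one, mul_zero]
  -- For `z = s • y` the coefficient is the sum of `x` over the coset of the stabilizer through `s`;
  -- off the orbit it vanishes.
  by_cases hz : ∃ s : G, s • y = z
  · obtain ⟨s, rfl⟩ := hz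
    refine (congrArg norm (Finset.sum_congr rfl fun g _ => ?_)).trans_le
      (hy.norm_sum_coset_le s x)
    simp only [MulAction.mem_stabilizer_iff, mul_smul, inv_smul_eq_iff]
  · rw [Finset.sum_eq_zero fun g _ => if_neg fun h => hz ⟨g, h⟩, norm_zero]
    exact norm_nonneg _

/-- The closed two-sided ideal of `C*_r(G)` generated by the annihilator of an orbit. -/
noncomputable def annihilatorIdeal (G : Type*) {Y : Type*} [Group G] [MulAction G Y] (y : Y) :
    TwoSidedIdeal (reducedGroupCStar G) :=
  .mk' (closure (groupAlgebraToReduced G '' orbitAnnihilator G y))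
    (subset_closure ⟨0, zero_mem _, map_zero _⟩)
    (fun ha hb => map_mem_closure₂ continuous_add ha hb (by
      rintro _ ⟨x, hx, rfl⟩ _ ⟨x', hx', rfl⟩
      exact ⟨_, add_mem hx hx', map_add _ _ _⟩))
    (fun ha => map_mem_closure continuous_neg ha (by
      rintro _ ⟨x, hx, rfl⟩
      exact ⟨_, neg_mem hx, map_neg _ _⟩))
    (fun {a _} hb => map_mem_closure₂ continuous_mul (denseRange_groupAlgebraToReduced G a) hb (by
      rintro _ ⟨x, rfl⟩ _ ⟨x', hx', rfl⟩
      exact ⟨_, mul_mem_orbitAnnihilator_left x hx', map_mul _ _ _⟩))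
    (fun {_ b} ha => map_mem_closure₂ continuous_mul ha (denseRange_groupAlgebraToReduced G b) (by
      rintro _ ⟨x, hx, rfl⟩ _ ⟨x', rfl⟩
      exact ⟨_, mul_mem_orbitAnnihilator_right x' hx, map_mul _ _ _⟩))

theorem coe_annihilatorIdeal (y : Y) : (annihilatorIdeal G y : Set (reducedGroupCStar G)) =
    closure (groupAlgebraToReduced G '' orbitAnnihilator G y) :=
  TwoSidedIdeal.coe_mk' _ _ _ _ _ _

theorem groupAlgebraToReduced_mem_annihilatorIdeal {y : Y} {x : MonoidAlgebra ℂ G}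
    (hx : x ∈ orbitAnnihilator G y) : groupAlgebraToReduced G x ∈ annihilatorIdeal G y := by
  rw [← SetLike.mem_coe, coe_annihilatorIdeal]
  exact subset_closure ⟨x, hx, rfl⟩

/-- Each matrix coefficient on the orbit is continuous for the reduced norm and vanishes on the
annihilator, hence on its closure. -/
theorem mem_orbitAnnihilator_of_mem_annihilatorIdeal {y : Y}
    (hy : IsAmenableGroup (MulAction.stabilizer G y)) {x : MonoidAlgebra ℂ G}
    (hx : groupAlgebraToReduced G x ∈ annihilatorIdeal G y) : x ∈ orbitAnnihilator G y := by
  rw [← SetLike.mem_coe, coe_annihilatorIdeal] at hx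
  intro b
  ext z
  rw [MonoidAlgebra.coeff_zero, Finsupp.zero_apply, ← norm_le_zero_iff]
  refine le_of_forall_pos_le_add fun ε hε => ?_
  obtain ⟨_, ⟨x', hx', rfl⟩, hd⟩ := Metric.mem_closure_iff.1 hx ε hε
  have h := norm_coeff_permAlgebraHom_le hy (x - x') b z
  rw [map_sub, LinearMap.sub_apply, hx' b, sub_zero, map_sub, ← dist_eq_norm] at h
  linarith

end

/-! ### Separating the ideals by disjoint supports -/

section

variable {G Y : Type*} [Group G] [MulAction G Y]

/-- The product `(1 - g₀) (1 - g₁) ⋯ (1 - gₙ₋₁)` in the group algebra. -/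
noncomputable def prodOneSub (g : ℕ → G) : ℕ → MonoidAlgebra ℂ G
  | 0 => 1
  | n + 1 => prodOneSub g n * (1 - MonoidAlgebra.of ℂ G (g n))

theorem permAlgebraHom_prodOneSub_succ (g : ℕ → G) (n : ℕ) (z : Y) :
    permAlgebraHom G Y (prodOneSub g (n + 1)) (MonoidAlgebra.single z 1) =
      permAlgebraHom G Y (prodOneSub g n) (MonoidAlgebra.single z 1) -
        permAlgebraHom G Y (prodOneSub g n) (MonoidAlgebra.single (g n • z) 1) := by
  rw [prodOneSub, map_mul, Module.End.mul_apply, map_sub, map_one, LinearMap.sub_apply,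
    permAlgebraHom_of_single, Module.End.one_apply, map_sub]

/-- Expanding the factors after `1 - g j` only produces translates of `z` that `g j` still fixes, by
commutation; the factor `1 - g j` kills these. -/
theorem permAlgebraHom_prodOneSub_eq_zero {g : ℕ → G} {n j : ℕ} (hj : j < n)
    (hg : ∀ i < n, Commute (g j) (g i)) {z : Y} (hz : g j • z = z) :
    permAlgebraHom G Y (prodOneSub g n) (MonoidAlgebra.single z 1) = 0 := by
  induction n generalizing z with
  | zero => omega
  | succ n ih =>
    rw [permAlgebraHom_prodOneSub_succ]
    rcases (Nat.lt_succ_iff_lt_or_eq.1 hj) with h | rfl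
    · have hg' : ∀ i < n, Commute (g j) (g i) := fun i hi => hg i (by omega)
      rw [ih h hg' hz, ih h hg', sub_zero]
      rw [← mul_smul, (hg n (by omega)).eq, mul_smul, hz]
    · rw [hz, sub_self]

variable {ι X : Type*} [MulAction G X]

/-- All tuples in the expansion share the `i`-th entry of `z`. -/
theorem coeff_permAlgebraHom_prodOneSub_eq_zero {g : ℕ → G} {n : ℕ} {z w : ι → X} {i : ι}
    (hz : ∀ j < n, g j • z i = z i) (hw : w i ≠ z i) :
    (permAlgebraHom G (ι → X) (prodOneSub g n) (MonoidAlgebra.single z 1)).coeff w = 0 := by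
  induction n generalizing z with
  | zero =>
    rw [prodOneSub, map_one, Module.End.one_apply, MonoidAlgebra.coeff_single,
      Finsupp.single_eq_of_ne]
    rintro rfl
    exact hw rfl
  | succ n ih =>
    have hn : (g n • z) i = z i := hz n (by omega)
    rw [permAlgebraHom_prodOneSub_succ, MonoidAlgebra.coeff_sub, Finsupp.sub_apply,
      ih (fun j hj => hz j (by omega)) hw, ih (fun j hj => ?_) (by rwa [hn]), sub_zero]
    rw [hn]
    exact hz j (by omega)

/-- Each new factor subtracts terms starting from `g n • y`. Their `n`-th entry stays at `g n • y
n`, which differs from `y n`, so `y` is never cancelled. -/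
theorem coeff_permAlgebraHom_prodOneSub_self {m : ℕ} {g : ℕ → G} {y : Fin m → X}
    (hne : ∀ i : Fin m, g i • y i ≠ y i)
    (hfix : ∀ i j : Fin m, j < i → g j • g i • y i = g i • y i) {n : ℕ} (hn : n ≤ m) :
    (permAlgebraHom G (Fin m → X) (prodOneSub g n) (MonoidAlgebra.single y 1)).coeff y = 1 := by
  induction n with
  | zero =>
    rw [prodOneSub, map_one, Module.End.one_apply, MonoidAlgebra.coeff_single,
      Finsupp.single_eq_same]
  | succ n ih =>
    rw [permAlgebraHom_prodOneSub_succ, MonoidAlgebra.coeff_sub, Finsupp.sub_apply,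
      ih (by omega), coeff_permAlgebraHom_prodOneSub_eq_zero (i := ⟨n, hn⟩), sub_zero]
    · exact fun j hj => hfix ⟨n, hn⟩ ⟨j, by omega⟩ hj
    · exact (hne ⟨n, hn⟩).symm

/-- A sequence `g₀, …, gₙ₋₁` of group elements with pairwise disjoint supports. -/
def PairwiseDisjointSupport (X : Type*) {G : Type*} [Group G] [MulAction G X] (g : ℕ → G)
    (n : ℕ) : Prop :=
  ∀ i < n, ∀ j < n, i ≠ j → ∀ x : X, g i • x = x ∨ g j • x = x

/-- The support of `h` is invariant under `h`. -/
theorem smul_smul_eq_of_disjoint {g h : G} (hgh : ∀ x : X, g • x = x ∨ h • x = x) {x : X}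
    (hx : h • x ≠ x) : g • h • x = h • x :=
  (hgh (h • x)).resolve_right fun H => hx (smul_left_cancel h H)

theorem Commute.of_disjoint_support [FaithfulSMul G X] {g h : G}
    (hgh : ∀ x : X, g • x = x ∨ h • x = x) : Commute g h := by
  refine FaithfulSMul.eq_of_smul_eq_smul (α := X) fun x => ?_
  rw [mul_smul, mul_smul]
  by_cases hh : h • x = x
  · by_cases hg : g • x = x
    · rw [hh, hg, hh]
    · rw [hh, smul_smul_eq_of_disjoint (fun x => (hgh x).symm) hg]
  · rw [smul_smul_eq_of_disjoint hgh hh, (hgh x).resolve_right hh]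

theorem prodOneSub_mem_orbitAnnihilator [FaithfulSMul G X] {g : ℕ → G} {n m : ℕ}
    (hg : PairwiseDisjointSupport X g n) (hmn : m < n) (y : Fin m → X) :
    prodOneSub g n ∈ orbitAnnihilator G y := by
  intro b
  generalize b • y = z
  -- Otherwise each of the `n` elements moves one of the `m < n` entries, so two of them move the
  -- same point.
  obtain ⟨j, hj, hjz⟩ : ∃ j < n, g j • z = z := by
    by_contra! h
    have h' : ∀ j : Fin n, ∃ i, g j • z i ≠ z i := fun j => by
      by_contra! H
      exact h j j.2 (funext H)
    choose f hf using h'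
    obtain ⟨i, j, hij, he⟩ := Fintype.exists_ne_map_eq_of_card_lt f (by simpa using hmn)
    rcases hg i i.2 j j.2 (by simpa [Fin.ext_iff] using hij) (z (f i)) with H | H
    · exact hf i H
    · rw [he] at H
      exact hf j H
  refine permAlgebraHom_prodOneSub_eq_zero hj (fun i hi => ?_) hjz
  rcases eq_or_ne j i with rfl | hne
  · exact Commute.refl _
  · exact Commute.of_disjoint_support (hg j hj i hi hne)

theorem prodOneSub_notMem_orbitAnnihilator {g : ℕ → G} {n : ℕ}
    (hg : PairwiseDisjointSupport X g n) {y : Fin n → X} (hy : ∀ i : Fin n, g i • y i ≠ y i) :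
    prodOneSub g n ∉ orbitAnnihilator G y := by
  intro h
  have h1 := coeff_permAlgebraHom_prodOneSub_self hy (fun i j hij =>
    smul_smul_eq_of_disjoint (hg j j.2 i i.2 (by simpa [Fin.ext_iff] using hij.ne)) (hy i)) le_rfl
  have h2 := h 1
  rw [one_smul] at h2
  rw [h2] at h1
  simp at h1

/-- A faithful action for which suitable tuples of arbitrary positive length have amenable
stabilizers produces infinitely many closed ideals in the reduced group C*-algebra. -/
theorem infinite_closed_ideals_of_disjoint_supports [FaithfulSMul G X]
    (H : ∀ n : ℕ, ∃ (g : ℕ → G) (y : Fin (n + 1) → X), PairwiseDisjointSupport X g (n + 1) ∧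
      (∀ i : Fin (n + 1), g i • y i ≠ y i) ∧ IsAmenableGroup (MulAction.stabilizer G y)) :
    {I : TwoSidedIdeal (reducedGroupCStar G) |
      IsClosed (I : Set (reducedGroupCStar G))}.Infinite := by
  choose g y hg hy hK using H
  have key : ∀ m n, m < n → annihilatorIdeal G (y m) ≠ annihilatorIdeal G (y n) := by
    intro m n hmn h
    have h1 := groupAlgebraToReduced_mem_annihilatorIdeal
      (prodOneSub_mem_orbitAnnihilator (hg n) (Nat.succ_lt_succ hmn) (y m))
    rw [h] at h1
    exact prodOneSub_notMem_orbitAnnihilator (hg n) (hy n)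
      (mem_orbitAnnihilator_of_mem_annihilatorIdeal (hK n) h1)
  refine Set.infinite_of_injective_forall_mem (f := fun n => annihilatorIdeal G (y n))
    (fun m n h => ?_) fun n => ?_
  · rcases lt_trichotomy m n with hlt | rfl | hlt
    · exact absurd h (key m n hlt)
    · rfl
    · exact absurd h.symm (key n m hlt)
  · change IsClosed (annihilatorIdeal G (y n) : Set (reducedGroupCStar G))
    rw [coe_annihilatorIdeal]
    exact isClosed_closure

end

/-! ### The action of `T` on the circle, and dyadic rotations -/

instance : MulAction thompsonT UnitAddCircle where
  smul g x := g.1 x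
  one_smul _ := rfl
  mul_smul _ _ _ := rfl

instance : FaithfulSMul thompsonT UnitAddCircle where
  eq_of_smul_eq_smul h := Subtype.ext (Homeomorph.ext h)

/-- The ring `ℤ[1/2]` of dyadic rationals. -/
noncomputable def dyadicReals : Subring ℝ where
  carrier := {t | ∃ (a : ℤ) (n : ℕ), t = (a : ℝ) / 2 ^ n}
  mul_mem' := by
    rintro _ _ ⟨a, n, rfl⟩ ⟨b, m, rfl⟩
    exact ⟨a * b, n + m, by push_cast; rw [pow_add]; field_simp⟩
  one_mem' := ⟨1, 0, by simp⟩
  add_mem' := by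
    rintro _ _ ⟨a, n, rfl⟩ ⟨b, m, rfl⟩
    exact ⟨a * 2 ^ m + b * 2 ^ n, n + m, by push_cast; rw [pow_add]; field_simp⟩
  zero_mem' := ⟨0, 0, by simp⟩
  neg_mem' := by
    rintro _ ⟨a, n, rfl⟩
    exact ⟨-a, n, by push_cast; ring⟩

theorem inv_two_pow_mem_dyadicReals (k : ℕ) : ((2 : ℝ) ^ k)⁻¹ ∈ dyadicReals :=
  ⟨1, k, by simp⟩

theorem half_mem_dyadicReals {t : ℝ} (ht : t ∈ dyadicReals) : t / 2 ∈ dyadicReals := by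
  have := mul_mem ht (inv_two_pow_mem_dyadicReals 1)
  rwa [pow_one] at this

theorem coe_mem_dyadicPoints_iff {t : ℝ} :
    (t : UnitAddCircle) ∈ dyadicPoints ↔ t ∈ dyadicReals := by
  constructor
  · rintro ⟨a, n, h⟩
    rw [← sub_eq_zero, ← AddCircle.coe_sub, AddCircle.coe_eq_zero_iff] at h
    obtain ⟨m, hm⟩ := h
    have : t = m + a / 2 ^ n := by
      rw [zsmul_eq_mul, mul_one] at hm
      linarith
    rw [this]
    exact add_mem (intCast_mem _ m) ⟨a, n, rfl⟩
  · rintro ⟨a, n, rfl⟩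
    exact ⟨a, n, rfl⟩

theorem UnitAddCircle.exists_coe_eq (x : UnitAddCircle) :
    ∃ t ∈ Set.Ico (0 : ℝ) 1, (t : UnitAddCircle) = x := by
  have h := AddCircle.coe_image_Ico_eq (1 : ℝ) 0
  rw [zero_add] at h
  exact h.ge (Set.mem_univ x)

theorem UnitAddCircle.coe_inj {s t : ℝ} (hs : s ∈ Set.Ico (0 : ℝ) 1) (ht : t ∈ Set.Ico (0 : ℝ) 1) :
    (s : UnitAddCircle) = t ↔ s = t :=
  AddCircle.coe_eq_coe_iff_of_mem_Ico (p := (1 : ℝ)) (a := 0) (by rwa [zero_add])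
    (by rwa [zero_add])

/-- The rotation by a dyadic angle as an element of Thompson's group `T`. -/
noncomputable def thompsonRotation (d : ℝ) (hd : d ∈ dyadicReals) : thompsonT :=
  ⟨Homeomorph.addRight (d : UnitAddCircle), by
    refine ⟨fun x => ?_, ∅, Set.finite_empty, Set.empty_subset _, fun x _ => ⟨0, ?_⟩⟩
    · obtain ⟨t, -, rfl⟩ := UnitAddCircle.exists_coe_eq x
      change (t : UnitAddCircle) + (d : UnitAddCircle) ∈ dyadicPoints ↔ _
      rw [← AddCircle.coe_add, coe_mem_dyadicPoints_iff,
        coe_mem_dyadicPoints_iff]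
      exact add_mem_cancel_right hd
    · filter_upwards with t
      simp only [Homeomorph.coe_addRight, zpow_zero, one_mul]
      abel⟩

theorem thompsonRotation_smul {d : ℝ} (hd : d ∈ dyadicReals) (x : UnitAddCircle) :
    thompsonRotation d hd • x = x + d := rfl

theorem thompsonRotation_inv_smul {d : ℝ} (hd : d ∈ dyadicReals) (x : UnitAddCircle) :
    (thompsonRotation d hd)⁻¹ • x = x - d := by
  rw [inv_smul_eq_iff, thompsonRotation_smul, sub_add_cancel]

/-! ### Elements of `T` supported in short arcs -/

/-- A pair of mutually inverse continuous maps of `[0, 1]` fixing the endpoints induces a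
homeomorphism of the circle. -/
noncomputable def circleHomeomorph (f f' : ℝ → ℝ) (hf : Continuous f) (hf' : Continuous f')
    (hI : Set.MapsTo f (Set.Ico 0 1) (Set.Ico 0 1))
    (hI' : Set.MapsTo f' (Set.Ico 0 1) (Set.Ico 0 1))
    (h0 : f 0 = 0) (h1 : f 1 = 1) (h0' : f' 0 = 0) (h1' : f' 1 = 1)
    (hl : Function.LeftInverse f' f) (hr : Function.RightInverse f' f) :
    UnitAddCircle ≃ₜ UnitAddCircle where
  toFun := AddCircle.liftIco 1 0 fun t => (f t : UnitAddCircle)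
  invFun := AddCircle.liftIco 1 0 fun t => (f' t : UnitAddCircle)
  left_inv x := by
    obtain ⟨t, ht, rfl⟩ := UnitAddCircle.exists_coe_eq x
    rw [AddCircle.liftIco_zero_coe_apply ht, AddCircle.liftIco_zero_coe_apply (hI ht), hl]
  right_inv x := by
    obtain ⟨t, ht, rfl⟩ := UnitAddCircle.exists_coe_eq x
    rw [AddCircle.liftIco_zero_coe_apply ht, AddCircle.liftIco_zero_coe_apply (hI' ht), hr]
  continuous_toFun := AddCircle.liftIco_zero_continuous
    (by rw [h0, h1, AddCircle.coe_period, AddCircle.coe_zero])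
    ((AddCircle.continuous_mk' 1).comp hf).continuousOn
  continuous_invFun := AddCircle.liftIco_zero_continuous
    (by rw [h0', h1', AddCircle.coe_period, AddCircle.coe_zero])
    ((AddCircle.continuous_mk' 1).comp hf').continuousOn

theorem isAffineAt_coe {g : UnitAddCircle ≃ₜ UnitAddCircle} {f : ℝ → ℝ}
    (hg : ∀ t ∈ Set.Ico (0 : ℝ) 1, g t = f t) {a b d : ℝ} {k : ℤ} (ha : 0 ≤ a) (hb : b ≤ 1)
    (hf : ∀ t ∈ Set.Ioo a b, f t = (2 : ℝ) ^ k * t + d) {t : ℝ} (ht : t ∈ Set.Ioo a b) :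
    IsAffineAt g t := by
  have hsub : Set.Ioo a b ⊆ Set.Ico 0 1 := fun u hu => ⟨ha.trans hu.1.le, hu.2.trans_le hb⟩
  refine ⟨k, ?_⟩
  have hc : Filter.Tendsto (fun s : ℝ => t + s) (𝓝 0) (𝓝 t) := by
    have : Continuous (fun s : ℝ => t + s) := by fun_prop
    simpa using this.tendsto 0
  filter_upwards [hc.eventually (Ioo_mem_nhds ht.1 ht.2)] with s hs
  rw [← AddCircle.coe_add, hg _ (hsub hs), hg _ (hsub ht), hf _ hs, hf _ ht, ← AddCircle.coe_add]
  congr 1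
  ring

/-- The piecewise linear map supported on `[0, c]` with slopes `1/2`, `1`, `2` there. -/
noncomputable def shrink (c t : ℝ) : ℝ := min t (max (t / 2) (max (t - c / 4) (2 * t - c)))

/-- The inverse of `shrink c`. -/
noncomputable def expand (c t : ℝ) : ℝ := max t (min (2 * t) (min (t + c / 4) ((t + c) / 2)))

theorem expand_shrink {c : ℝ} (hc : 0 < c) (t : ℝ) : expand c (shrink c t) = t := by
  unfold expand shrink
  grind

theorem shrink_expand {c : ℝ} (hc : 0 < c) (t : ℝ) : shrink c (expand c t) = t := by
  unfold expand shrink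
  grind

theorem shrink_mem_dyadicReals {c t : ℝ} (hc : c ∈ dyadicReals) (ht : t ∈ dyadicReals) :
    shrink c t ∈ dyadicReals := by
  have h4 : c / 4 ∈ dyadicReals := by
    convert half_mem_dyadicReals (half_mem_dyadicReals hc) using 1
    ring
  exact min_rec' (· ∈ dyadicReals) ht (max_rec' (· ∈ dyadicReals) (half_mem_dyadicReals ht)
    (max_rec' (· ∈ dyadicReals) (sub_mem ht h4) (sub_mem (mul_mem (ofNat_mem _ 2) ht) hc)))

theorem expand_mem_dyadicReals {c t : ℝ} (hc : c ∈ dyadicReals) (ht : t ∈ dyadicReals) :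
    expand c t ∈ dyadicReals := by
  have h4 : c / 4 ∈ dyadicReals := by
    convert half_mem_dyadicReals (half_mem_dyadicReals hc) using 1
    ring
  exact max_rec' (· ∈ dyadicReals) ht (min_rec' (· ∈ dyadicReals) (mul_mem (ofNat_mem _ 2) ht)
    (min_rec' (· ∈ dyadicReals) (add_mem ht h4) (half_mem_dyadicReals (add_mem ht hc))))

/-- The homeomorphism of the circle induced by `shrink c`. -/
noncomputable def shrinkHomeomorph (c : ℝ) (hc : 0 < c) (hc1 : c ≤ 1) : UnitAddCircle ≃ₜ UnitAddCircle :=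
  circleHomeomorph (shrink c) (expand c) (by unfold shrink; fun_prop) (by unfold expand; fun_prop)
    (fun t ht => by
      obtain ⟨h0, h1⟩ := ht
      unfold shrink
      constructor <;> grind)
    (fun t ht => by
      obtain ⟨h0, h1⟩ := ht
      unfold expand
      constructor <;> grind)
    (by unfold shrink; grind) (by unfold shrink; grind) (by unfold expand; grind)
    (by unfold expand; grind) (expand_shrink hc) (shrink_expand hc)

theorem shrinkHomeomorph_coe {c : ℝ} (hc : 0 < c) (hc1 : c ≤ 1) {t : ℝ}
    (ht : t ∈ Set.Ico (0 : ℝ) 1) : shrinkHomeomorph c hc hc1 t = shrink c t :=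
  AddCircle.liftIco_zero_coe_apply (f := fun t => (shrink c t : UnitAddCircle)) ht

theorem isThompson_shrinkHomeomorph {c : ℝ} (hc : 0 < c) (hc1 : c ≤ 1) (hd : c ∈ dyadicReals) :
    IsThompson (shrinkHomeomorph c hc hc1) := by
  -- The third breakpoint is `3 * c / 4`, written so that dyadicity follows by halving.
  refine ⟨fun x => ?_, (fun t : ℝ => (t : UnitAddCircle)) '' {0, c / 2, c / 2 + c / 2 / 2, c},
    Set.Finite.image _ (by simp), ?_, fun x hx => ?_⟩
  · obtain ⟨t, ht, rfl⟩ := UnitAddCircle.exists_coe_eq x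
    rw [shrinkHomeomorph_coe hc hc1 ht, coe_mem_dyadicPoints_iff, coe_mem_dyadicPoints_iff]
    refine ⟨fun h => ?_, shrink_mem_dyadicReals hd⟩
    rw [← expand_shrink hc t]
    exact expand_mem_dyadicReals hd h
  · rintro _ ⟨t, ht, rfl⟩
    refine coe_mem_dyadicPoints_iff.2 ?_
    have h2 := half_mem_dyadicReals hd
    rcases ht with rfl | rfl | rfl | rfl
    · exact zero_mem _
    · exact h2
    · exact add_mem h2 (half_mem_dyadicReals h2)
    · exact hd
  · obtain ⟨t, ht, rfl⟩ := UnitAddCircle.exists_coe_eq x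
    have hg := fun t ht => shrinkHomeomorph_coe hc hc1 (t := t) ht
    have hne : ∀ s ∈ ({0, c / 2, c / 2 + c / 2 / 2, c} : Set ℝ), t ≠ s := by
      rintro s hs rfl
      exact hx ⟨t, hs, rfl⟩
    simp only [Set.mem_insert_iff, Set.mem_singleton_iff, forall_eq_or_imp, forall_eq] at hne
    obtain ⟨n0, n1, n2, n3⟩ := hne
    have h0 : 0 < t := lt_of_le_of_ne ht.1 (Ne.symm n0)
    rcases lt_or_gt_of_ne n1 with h1 | h1
    · refine isAffineAt_coe hg le_rfl (by linarith) (k := -1) (d := 0) ?_ ⟨h0, h1⟩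
      rintro u ⟨hu, hu'⟩
      rw [zpow_neg_one]
      unfold shrink
      grind
    rcases lt_or_gt_of_ne n2 with h2 | h2
    · refine isAffineAt_coe hg (by linarith) (by linarith) (k := 0) (d := -c / 4) ?_ ⟨h1, h2⟩
      rintro u ⟨hu, hu'⟩
      rw [zpow_zero]
      unfold shrink
      grind
    rcases lt_or_gt_of_ne n3 with h3 | h3
    · refine isAffineAt_coe hg (by linarith) (by linarith) (k := 1) (d := -c) ?_ ⟨h2, h3⟩
      rintro u ⟨hu, hu'⟩
      rw [zpow_one]
      unfold shrink
      grind
    · refine isAffineAt_coe hg hc.le le_rfl (k := 0) (d := 0) ?_ ⟨h3, ht.2⟩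
      rintro u ⟨hu, hu'⟩
      rw [zpow_zero]
      unfold shrink
      grind

/-- The element of Thompson's group `T` induced by `shrink c`. -/
noncomputable def thompsonShrink (c : ℝ) (hc : 0 < c) (hc1 : c ≤ 1) (hd : c ∈ dyadicReals) : thompsonT :=
  ⟨shrinkHomeomorph c hc hc1, isThompson_shrinkHomeomorph hc hc1 hd⟩

theorem thompsonShrink_smul_coe {c : ℝ} (hc : 0 < c) (hc1 : c ≤ 1) (hd : c ∈ dyadicReals) {t : ℝ}
    (ht : t ∈ Set.Ico (0 : ℝ) 1) :
    thompsonShrink c hc hc1 hd • (t : UnitAddCircle) = (shrink c t : UnitAddCircle) :=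
  shrinkHomeomorph_coe hc hc1 ht

theorem exists_of_thompsonShrink_smul_ne {c : ℝ} (hc : 0 < c) (hc1 : c ≤ 1) (hd : c ∈ dyadicReals)
    {x : UnitAddCircle} (hx : thompsonShrink c hc hc1 hd • x ≠ x) :
    ∃ t ∈ Set.Ioo 0 c, x = (t : UnitAddCircle) := by
  obtain ⟨t, ht, rfl⟩ := UnitAddCircle.exists_coe_eq x
  refine ⟨t, ?_, rfl⟩
  rw [thompsonShrink_smul_coe hc hc1 hd ht] at hx
  have h : shrink c t ≠ t := fun h => hx (by rw [h])
  unfold shrink at h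
  constructor <;> grind

/-! ### Disjoint supports in `T` and the conclusion -/

/-- For every `n` there are `n + 1` elements of `T` with disjoint supports, together with a point
in each support, one of these points being `0`. -/
theorem exists_thompsonT_disjoint_supports (n : ℕ) :
    ∃ (g : ℕ → thompsonT) (y : Fin (n + 1) → UnitAddCircle),
      PairwiseDisjointSupport UnitAddCircle g (n + 1) ∧
      (∀ i : Fin (n + 1), g i • y i ≠ y i) ∧ y 0 = 0 := by
  -- `n + 1` arcs of the dyadic length `c = 2 ^ (-k)` fit into the circle.
  obtain ⟨k, hk⟩ : ∃ k : ℕ, n + 1 ≤ 2 ^ k := ⟨n + 1, Nat.lt_two_pow_self.le⟩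
  obtain ⟨c, hceq⟩ : ∃ c : ℝ, c = ((2 : ℝ) ^ k)⁻¹ := ⟨_, rfl⟩
  have hd : c ∈ dyadicReals := hceq ▸ inv_two_pow_mem_dyadicReals k
  have hc : 0 < c := by rw [hceq]; positivity
  have hc1 : c ≤ 1 := by
    rw [hceq]
    exact inv_le_one_of_one_le₀ (one_le_pow₀ one_le_two)
  have hnc : ((n : ℝ) + 1) * c ≤ 1 := by
    rw [hceq, ← div_eq_mul_inv, div_le_one (by positivity)]
    exact_mod_cast hk
  -- This rotation carries the arc `(0, c)` to the arc centred at `j * c`, so that `0` is the centre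
  -- of the arc with `j = 0`. That arc wraps around `0`; adding `c / 2` puts all arcs back into `[0,
  -- 1)` for comparison.
  have hrot : ∀ j : ℕ, (j : ℝ) * c - c / 2 ∈ dyadicReals := fun j =>
    sub_mem (mul_mem (natCast_mem _ j) hd) (half_mem_dyadicReals hd)
  let r : ℕ → thompsonT := fun j => thompsonRotation _ (hrot j)
  let h := thompsonShrink c hc hc1 hd
  let g : ℕ → thompsonT := fun j => r j * h * (r j)⁻¹
  have hgne : ∀ (j : ℕ) (x : UnitAddCircle), g j • x ≠ x ↔ h • (r j)⁻¹ • x ≠ (r j)⁻¹ • x := by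
    intro j x
    rw [not_iff_not, mul_smul, mul_smul, ← eq_inv_smul_iff]
  have hsupp : ∀ (j : ℕ) (x : UnitAddCircle), g j • x ≠ x →
      ∃ t ∈ Set.Ioo 0 c, x + ((c / 2 : ℝ) : UnitAddCircle) = ((t + j * c : ℝ) : UnitAddCircle) := by
    intro j x hx
    obtain ⟨t, ht, hxt⟩ := exists_of_thompsonShrink_smul_ne hc hc1 hd ((hgne j x).1 hx)
    refine ⟨t, ht, ?_⟩
    rw [inv_smul_eq_iff, thompsonRotation_smul] at hxt
    rw [hxt, ← AddCircle.coe_add, ← AddCircle.coe_add]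
    congr 1
    ring
  have hIco : ∀ j < n + 1, ∀ t ∈ Set.Ioo 0 c, t + j * c ∈ Set.Ico (0 : ℝ) 1 := by
    intro j hj t ht
    have hj' : (j : ℝ) + 1 ≤ n + 1 := by exact_mod_cast hj
    have hj0 : (0 : ℝ) ≤ j * c := by positivity
    have := mul_le_mul_of_nonneg_right hj' hc.le
    exact ⟨by linarith [ht.1], by linarith [ht.2]⟩
  have hlt : ∀ i j : ℕ, ∀ t ∈ Set.Ioo 0 c, ∀ s ∈ Set.Ioo 0 c,
      t + i * c = s + j * c → i ≤ j := by
    intro i j t ht s hs h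
    have h1 : (i : ℝ) * c < (j + 1) * c := by linarith [ht.1, hs.2]
    have h2 := lt_of_mul_lt_mul_right h1 hc.le
    exact Nat.lt_succ_iff.1 (by exact_mod_cast h2)
  refine ⟨g, fun i => (((i : ℕ) * c : ℝ) : UnitAddCircle), fun i hi j hj hij x => ?_, fun i => ?_,
    by simp⟩
  · by_contra! H
    obtain ⟨t, ht, hxt⟩ := hsupp i x H.1
    obtain ⟨s, hs, hxs⟩ := hsupp j x H.2
    have heq := (UnitAddCircle.coe_inj (hIco i hi t ht) (hIco j hj s hs)).1 (hxt.symm.trans hxs)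
    exact hij (le_antisymm (hlt i j t ht s hs heq) (hlt j i s hs t ht heq.symm))
  · rw [hgne, thompsonRotation_inv_smul, ← AddCircle.coe_sub, sub_sub_cancel,
      thompsonShrink_smul_coe hc hc1 hd ⟨by linarith, by linarith⟩]
    have hs : shrink c (c / 2) = c / 4 := by
      unfold shrink
      grind
    rw [hs, Ne, UnitAddCircle.coe_inj ⟨by linarith, by linarith⟩ ⟨by linarith, by linarith⟩]
    linarith

/-- If Thompson's group `F` is amenable, then `C*_r(T)` has infinitely many closed two-sided
ideals. -/
theorem theorem4p9 (hF : IsAmenableGroup thompsonF) :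
    {I : TwoSidedIdeal (reducedGroupCStar thompsonT) |
      IsClosed (I : Set (reducedGroupCStar thompsonT))}.Infinite := by
  refine infinite_closed_ideals_of_disjoint_supports (X := UnitAddCircle) fun n => ?_
  obtain ⟨g, y, hg, hy, hy0⟩ := exists_thompsonT_disjoint_supports n
  refine ⟨g, y, hg, hy, ?_⟩
  have hle : MulAction.stabilizer thompsonT y ≤ thompsonF := by
    intro k hk
    have h := congrFun (MulAction.mem_stabilizer_iff.1 hk) 0
    rw [Pi.smul_apply, hy0] at h
    exact h
  exact hF.of_injective (Subgroup.inclusion hle) (Subgroup.inclusion_injective hle)
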